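/- Let $n=2m$ be an even positive integer. For a subset $R\subseteq\mathbb{Z}_n=\mathbb{Z}/n\mathbb{Z}$, let $H(\mathbb{Z}_n,R)$ denote the Haar graph: the bipartite graph whose colour classes are two disjoint copies $\mathbb{Z}_n^+=\{x^+ : x\in\mathbb{Z}_n\}$ and $\mathbb{Z}_n^-=\{x^- : x\in\mathbb{Z}_n\}$ of $\mathbb{Z}_n$, and whose edges are the pairs $\{x^+,y^-\}$ with $x,y\in\mathbb{Z}_n$ and $y-x\in R$. Let $u,v$ be integers and let $S=\{0,u,v,v+m\}\subseteq\mathbb{Z}_n$ (residues modulo $n$) be such that (a) $\mathbb{Z}_n=\langle u,v\rangle$; (b) $1<u<m$ and $u\mid m$; (c) every automorphism of the graph $H(\mathbb{Z}_n,S)$ that fixes the vertex $0^+$ leaves the set $\{0^-,u^-\}$ setwise fixed. Then, for every subset $T\subseteq\mathbb{Z}_n$, the graphs $H(\mathbb{Z}_n,S)$ and $H(\mathbb{Z}_n,T)$ are isomorphic if and only if there exist $a\in\mathbb{Z}_n^*$ (a unit of the ring $\mathbb{Z}/n\mathbb{Z}$) and $b\in\mathbb{Z}_n$ such that (1) $aT+b=S$;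 or (2) $aT+b=\{0,u+m,v,v+m\}$, and $2\mid u$, $2u\mid m$, and $u/2\not\equiv v+m/(2u)\pmod{m/u}$. Here $aT+b=\{at+b : t\in T\}$. -/

import Mathlib

/-- The Haar graph `H(G, S)` of an additive group `G`: `Sum.inl x` is the vertex `x⁺`,
`Sum.inr y` is the vertex `y⁻`, and the edges are the pairs `{x⁺, y⁻}` with `y - x ∈ S`. -/
def haarGraph {G : Type*} [AddGroup G] (S : Set G) : SimpleGraph (G ⊕ G) where
  Adj p q :=
    match p, q with
    | Sum.inl x, Sum.inr y => y - x ∈ S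
    | Sum.inr y, Sum.inl x => y - x ∈ S
    | Sum.inl _, Sum.inl _ => False
    | Sum.inr _, Sum.inr _ => False
  symm := ⟨by rintro (x | x) (y | y) h <;> exact h⟩
  loopless := ⟨by rintro (x | x) h <;> exact h⟩

/-!
Translations of `ℤ/n` act on every Haar graph, so an isomorphism `H(S) → H(T)` may be assumed to
fix `0⁺` and `0⁻`. Conjugating translations by it gives automorphisms of `H(S)` fixing `0⁺`, so by
hypothesis (c) it restricts to the subgraphs `H({0, u})`, a union of cycles, and `H({v, v + m})`, a
union of 4-cycles. Up to a unit fixing `m`, it therefore walks along the cycle through `0⁺` by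
`u ↦ u`, commutes with `x ↦ x + m`, and `T = {0, u, z, z + m}`. The vertex `uv` can be reached from
`0` by `u` steps of `v` or by `v` steps of `u`; comparing the images gives `2uv = 2uz`, that is
`z ≡ v` modulo `k = m / u`. (For `k = 2` this argument fails, but `z` or `u - z` has the parity of
`v`, and `x ↦ u - x` exchanges `z` and `u - z` up to `m`.)

A unit `1 + kb` then takes `z` to `v` or `v + m`. It takes `u` to `u + bm`, so it fixes `u` if `b`
is even, while an odd `b` leads to the set `{0, u + m, v, v + m}`; the congruence excluded in (2)
says that after the reflection `x ↦ u - x` an even `b` is available. Conversely, if `2u ∣ m`, adding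
`m` to every other vertex of the cycles `x, x + u, x + 2u, …` turns `S` into `{0, u + m, v, v + m}`.
-/

section HaarGraph

variable {G : Type*} [AddCommGroup G] {S T B : Set G} {P Q : Equiv.Perm G}

theorem haarGraph_connected_iff (h0 : 0 ∈ S) :
    (haarGraph S).Connected ↔ AddSubgroup.closure S = ⊤ := by
  constructor
  · intro h
    have walk_mem : ∀ {p q : G ⊕ G}, (haarGraph S).Walk p q →
        q.elim id id - p.elim id id ∈ AddSubgroup.closure S := by
      intro p q w
      induction w with
      | nil => simp
      | @cons p q r hpq _ ih =>
        rw [← sub_add_sub_cancel _ (q.elim id id)]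
        refine add_mem ih ?_
        rcases p with x | x <;> rcases q with y | y
        · exact hpq.elim
        · exact AddSubgroup.subset_closure hpq
        · exact neg_sub x y ▸ neg_mem (AddSubgroup.subset_closure hpq)
        · exact hpq.elim
    refine (AddSubgroup.eq_top_iff' _).2 fun g => ?_
    obtain ⟨w⟩ := h.preconnected (Sum.inl 0) (Sum.inl g)
    simpa using walk_mem w
  · intro h
    have adj_self (x : G) : (haarGraph S).Adj (Sum.inl x) (Sum.inr x) :=
      show x - x ∈ S by rwa [sub_self]
    have reachable_add : ∀ g x : G, (haarGraph S).Reachable (Sum.inl x) (Sum.inl (x + g)) := by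
      intro g
      induction h ▸ AddSubgroup.mem_top g using AddSubgroup.closure_induction with
      | mem s hs =>
        intro x
        have hadj : (haarGraph S).Adj (Sum.inl x) (Sum.inr (x + s)) :=
          show x + s - x ∈ S by rwa [add_sub_cancel_left]
        exact hadj.reachable.trans (adj_self _).symm.reachable
      | zero => simp
      | add a b _ _ ha hb => exact fun x => add_assoc x a b ▸ (ha x).trans (hb (x + a))
      | neg a _ ha => exact fun x => by simpa using (ha (x + -a)).symm
    refine SimpleGraph.connected_iff_exists_forall_reachable _ |>.2 ⟨Sum.inl 0, ?_⟩
    rintro (x | x)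
    · simpa using reachable_add x 0
    · simpa using (reachable_add x 0).trans (adj_self _).reachable

theorem isLeft_ne_of_haarGraph_adj {p q : G ⊕ G} (h : (haarGraph S).Adj p q) :
    p.isLeft ≠ q.isLeft := by
  rcases p with x | x <;> rcases q with y | y <;> simp_all [haarGraph]

theorem isLeft_map_of_haarGraph_connected (hS : (haarGraph S).Connected)
    (f : haarGraph S →g haarGraph T) (hf : (f (Sum.inl 0)).isLeft) (p : G ⊕ G) :
    (f p).isLeft = p.isLeft := by
  obtain ⟨w⟩ := hS.preconnected (Sum.inl 0) p
  have h₁ := (SimpleGraph.Coloring.mk (G := haarGraph S) Sum.isLeft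
    isLeft_ne_of_haarGraph_adj).even_length_iff_congr w
  have h₂ := (SimpleGraph.Coloring.mk (G := haarGraph T) Sum.isLeft
    isLeft_ne_of_haarGraph_adj).even_length_iff_congr (w.map f)
  rw [SimpleGraph.Walk.length_map, h₁] at h₂
  change ((Sum.inl 0 : G ⊕ G).isLeft ↔ p.isLeft) ↔ ((f (Sum.inl 0)).isLeft ↔ (f p).isLeft) at h₂
  exact Bool.eq_iff_iff.2 (by simpa [hf] using h₂.symm)

/-- The automorphism `x⁺ ↦ (-x)⁻`, `y⁻ ↦ (-y)⁺` of a Haar graph, which swaps the two colour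
classes. -/
def haarSwap (T : Set G) : haarGraph T ≃g haarGraph T where
  toEquiv := (Equiv.sumComm G G).trans (Equiv.sumCongr (Equiv.neg G) (Equiv.neg G))
  map_rel_iff' := by
    rintro (x | x) (y | y)
    exacts [Iff.rfl, Eq.to_iff (congrArg (· ∈ T) (neg_sub_neg x y)),
      Eq.to_iff (congrArg (· ∈ T) (neg_sub_neg y x)), Iff.rfl]

/-- The permutations `P` of `G⁺` and `Q` of `G⁻` together are an isomorphism from `H(G, S)` to
`H(G, T)`. -/
def IsHaarIso (S T : Set G) (P Q : Equiv.Perm G) : Prop :=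
  ∀ x y, y - x ∈ S ↔ Q y - P x ∈ T

/-- The colour-preserving graph isomorphism with components `P` and `Q`. -/
def IsHaarIso.toIso (h : IsHaarIso S T P Q) : haarGraph S ≃g haarGraph T where
  toEquiv := Equiv.sumCongr P Q
  map_rel_iff' := by
    rintro (x | x) (y | y)
    exacts [Iff.rfl, (h x y).symm, (h y x).symm, Iff.rfl]

theorem exists_isHaarIso [Finite G] (hS : (haarGraph S).Connected)
    (f : haarGraph S ≃g haarGraph T) : ∃ P Q, IsHaarIso S T P Q := by
  wlog hf : (f (Sum.inl 0)).isLeft generalizing f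
  · refine this (f.trans (haarSwap T)) ?_
    obtain ⟨y, hy⟩ := Sum.isRight_iff.1 (Sum.not_isLeft.1 hf)
    rw [RelIso.trans_apply, hy]
    rfl
  have hmaps : Set.MapsTo f.toEquiv (Set.range Sum.inl) (Set.range Sum.inl) := by
    rintro _ ⟨x, rfl⟩
    have hx : (f (Sum.inl x)).isLeft :=
      isLeft_map_of_haarGraph_connected hS f.toHom hf (Sum.inl x)
    obtain ⟨y, hy⟩ := Sum.isLeft_iff.1 hx
    exact ⟨y, hy.symm⟩
  obtain ⟨⟨P, Q⟩, hPQ⟩ := Equiv.Perm.mem_sumCongrHom_range_of_perm_mapsTo_inl hmaps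
  refine ⟨P, Q, fun x y => ?_⟩
  have hadj := f.map_adj_iff (v := Sum.inl x) (w := Sum.inr y)
  have hfPQ (p : G ⊕ G) : f p = Sum.map P Q p := (Equiv.congr_fun hPQ p).symm
  rw [hfPQ, hfPQ] at hadj
  exact hadj.symm

namespace IsHaarIso

theorem symm (h : IsHaarIso S T P Q) : IsHaarIso T S P.symm Q.symm := fun x y => by
  rw [h, P.apply_symm_apply, Q.apply_symm_apply]

theorem trans {S' : Set G} {P' Q' : Equiv.Perm G} (h : IsHaarIso S T P Q)
    (h' : IsHaarIso T S' P' Q') : IsHaarIso S S' (P.trans P') (Q.trans Q') := fun x y =>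
  (h x y).trans (h' (P x) (Q y))

theorem addRight (S : Set G) (c : G) :
    IsHaarIso S S (Equiv.addRight c) (Equiv.addRight c) := fun x y => by simp

theorem union {S' T' : Set G} (h : IsHaarIso S T P Q) (h' : IsHaarIso S' T' P Q) :
    IsHaarIso (S ∪ S') (T ∪ T') P Q := fun x y => or_congr (h x y) (h' x y)

theorem image_eq (h : IsHaarIso S T P Q) (hP : P 0 = 0) : Q '' S = T := by
  ext t
  rw [Equiv.image_eq_preimage_symm, Set.mem_preimage]
  simpa [hP] using h 0 (Q.symm t)

end IsHaarIso

/-- The set `B` of neighbours of `0⁺` in `H(G, S)` is setwise fixed by the colour-preserving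
automorphisms that fix `0⁺`. -/
def StabilizerInvariant (S B : Set G) : Prop :=
  ∀ ⦃P Q : Equiv.Perm G⦄, IsHaarIso S S P Q → P 0 = 0 → Q '' B = B

theorem stabilizerInvariant_of_forall_iso
    (h : ∀ g : haarGraph S ≃g haarGraph S, g (Sum.inl 0) = Sum.inl 0 →
      g '' (Sum.inr '' B) = Sum.inr '' B) : StabilizerInvariant S B := by
  intro P Q hPQ hP
  refine (Sum.inr_injective (α := G)).image_injective ?_
  rw [← h hPQ.toIso (congrArg Sum.inl hP), Set.image_image, Set.image_image]
  rfl

theorem StabilizerInvariant.sdiff (hB : StabilizerInvariant S B) :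
    StabilizerInvariant S (S \ B) := fun P Q h hP => by
  rw [Set.image_sdiff Q.injective, h.image_eq hP, hB h hP]

-- Conjugating translations by the isomorphism gives an automorphism that fixes `0⁺` and takes
-- `(y - x)⁻` to `(Q⁻¹ (Q y - P x))⁻`.
theorem IsHaarIso.restrict (h : IsHaarIso S T P Q) (hP : P 0 = 0)
    (hB : StabilizerInvariant S B) : IsHaarIso B (Q '' B) P Q := by
  intro x y
  have haut := (((addRight S x).trans h).trans (addRight T (-P x))).trans h.symm
  have himage := hB haut (by simp [P.symm_apply_eq, hP])
  rw [← (Equiv.injective _).mem_set_image (s := B), himage, Q.image_eq_preimage_symm]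
  simp [sub_eq_add_neg]

namespace IsHaarIso

variable {U V W Z Z' M x : G}

theorem map_add_fst (h : IsHaarIso {U, V} {W, Z} P Q) (x : G) :
    Q (x + U) = P x + W ∨ Q (x + U) = P x + Z := by
  simpa [sub_eq_iff_eq_add'] using (h x (x + U)).1 (by simp)

theorem map_add_snd (h : IsHaarIso {U, V} {W, Z} P Q) (x : G) :
    Q (x + V) = P x + W ∨ Q (x + V) = P x + Z :=
  map_add_fst (by rwa [Set.pair_comm V U]) x

theorem map_eq_or (h : IsHaarIso {0, U} {0, W} P Q) (x : G) : Q x = P x ∨ Q x = P x + W := by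
  simpa using h.map_add_fst x

theorem map_add_eq_or (h : IsHaarIso {0, U} {0, W} P Q) (x : G) :
    Q (x + U) = P x ∨ Q (x + U) = P x + W := by
  simpa using h.map_add_snd x

-- The edges of difference `0` and `U` form cycles. The next two lemmas say that each cycle is
-- traversed either in the same or in the opposite direction by its image.
theorem map_add_of_map_eq (h : IsHaarIso {0, U} {0, W} P Q) (hU : U ≠ 0) (hx : Q x = P x) :
    P (x + U) = P x + W ∧ Q (x + U) = P (x + U) := by
  have hne : x + U ≠ x := by simpa using hU
  have hQ : Q (x + U) = P x + W :=
    (h.map_add_eq_or x).resolve_left fun h' => hne (Q.injective (h'.trans hx.symm))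
  have hQP : Q (x + U) = P (x + U) :=
    (h.map_eq_or (x + U)).resolve_right fun h' =>
      hne (P.injective (add_right_cancel (h'.symm.trans hQ)))
  exact ⟨hQP.symm.trans hQ, hQP⟩

theorem map_add_of_map_ne (h : IsHaarIso {0, U} {0, W} P Q) (hU : U ≠ 0) (hx : Q x ≠ P x) :
    Q x = P x + W ∧ Q (x + U) = P x := by
  have hQx : Q x = P x + W := (h.map_eq_or x).resolve_left hx
  refine ⟨hQx, (h.map_add_eq_or x).resolve_right fun h' => ?_⟩
  exact hU (by simpa using Q.injective (h'.trans hQx.symm))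

theorem map_nsmul (h : IsHaarIso {0, U} {0, W} P Q) (hU : U ≠ 0) (hP : P 0 = 0) (hQ : Q 0 = 0)
    (j : ℕ) : P (j • U) = j • W := by
  suffices P (j • U) = j • W ∧ Q (j • U) = P (j • U) from this.1
  induction j with
  | zero => simp [hP, hQ]
  | succ j ih =>
    have hstep := h.map_add_of_map_eq hU ih.2
    rwa [ih.1, ← succ_nsmul, ← succ_nsmul] at hstep

theorem map_add_involution (h : IsHaarIso {V, V + M} {Z, Z'} P Q) (hM : M ≠ 0)
    (hMM : M + M = 0) (huniq : ∀ d : G, d + d = 0 → d = 0 ∨ d = M) :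
    Z' = Z + M ∧ ∀ x, P (x + M) = P x + M := by
  have hP (x : G) : P (x + M) ≠ P x := fun hx => hM (by simpa using P.injective hx)
  -- `x⁺` and `(x + M)⁺` have the same two neighbours.
  have hnbr (x y : G) (hy : y = P x + Z ∨ y = P x + Z') :
      y = P (x + M) + Z ∨ y = P (x + M) + Z' := by
    have hS (y : G) : y - x ∈ ({V, V + M} : Set G) ↔ y - (x + M) ∈ ({V, V + M} : Set G) := by
      have hVM : x + M + (V + M) = x + V := by linear_combination (norm := module) hMM
      simp only [Set.mem_insert_iff, Set.mem_singleton_iff, sub_eq_iff_eq_add', hVM]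
      rw [or_comm, add_right_comm, add_assoc]
    have hT := (h x (Q.symm y)).symm.trans ((hS _).trans (h (x + M) (Q.symm y)))
    simp only [Q.apply_symm_apply, Set.mem_insert_iff, Set.mem_singleton_iff,
      sub_eq_iff_eq_add'] at hT
    exact hT.1 hy
  have hcross (x : G) : P x + Z = P (x + M) + Z' ∧ P x + Z' = P (x + M) + Z := by
    refine ⟨(hnbr x _ (Or.inl rfl)).resolve_left fun h' => ?_,
      (hnbr x _ (Or.inr rfl)).resolve_right fun h' => ?_⟩
    · exact hP x (add_right_cancel h').symm
    · exact hP x (add_right_cancel h').symm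
  have hZ : Z' - Z = M := by
    refine (huniq (Z' - Z) ?_).resolve_left fun h' => hP 0 ?_
    · linear_combination (norm := module) (hcross 0).2 - (hcross 0).1
    · linear_combination (norm := module) h' - (hcross 0).2
  refine ⟨eq_add_of_sub_eq' hZ, fun x => ?_⟩
  linear_combination (norm := module) hZ - (hcross x).2

theorem map_add_eq_of_map_eq (hB : IsHaarIso {0, U} {0, W} P Q)
    (hC : IsHaarIso {V, V + M} {Z, Z + M} P Q) (hU : U ≠ 0) (hMM : M + M = 0)
    (hW : 4 • W ≠ 0) (hx : Q x = P x) : Q (x + V) = P (x + V) := by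
  by_contra hne
  obtain ⟨hQV, hQVU⟩ := hB.map_add_of_map_ne hU hne
  have hPU := (hB.map_add_of_map_eq hU hx).1
  have hQUV := hC.map_add_fst (x + U)
  rw [add_right_comm, hQVU, hPU] at hQUV
  have hcases := hC.map_add_fst x
  rw [hQV] at hcases
  refine hW ?_
  rcases hcases with h | h <;> rcases hQUV with h' | h'
  · linear_combination (norm := module) (2 : ℤ) • (h - h')
  · linear_combination (norm := module) (2 : ℤ) • (h - h') - hMM
  · linear_combination (norm := module) (2 : ℤ) • (h - h') + hMM
  · linear_combination (norm := module) (2 : ℤ) • (h - h')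

theorem two_nsmul_nsmul_eq (hB : IsHaarIso {0, U} {0, W} P Q)
    (hC : IsHaarIso {V, V + M} {Z, Z + M} P Q) (hU : U ≠ 0) (hMM : M + M = 0)
    (hW : 4 • W ≠ 0) (hP : P 0 = 0) (hQ : Q 0 = 0) {i j : ℕ} (hij : i • V = j • U) :
    2 • i • Z = 2 • j • W := by
  have hwalk (i : ℕ) : 2 • P (i • V) = 2 • i • Z ∧ Q (i • V) = P (i • V) := by
    induction i with
    | zero => simp [hP, hQ]
    | succ i ih =>
      have hQV := hB.map_add_eq_of_map_eq hC hU hMM hW ih.2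
      rw [succ_nsmul V, ← hQV]
      refine ⟨?_, rfl⟩
      rcases hC.map_add_fst (i • V) with h | h
      · linear_combination (norm := module) (2 : ℤ) • h + ih.1
      · linear_combination (norm := module) (2 : ℤ) • h + ih.1 + hMM
  rw [← (hwalk i).1, hij, hB.map_nsmul hU hP hQ]

end IsHaarIso

theorem isHaarIso_zero_pair {U W : G} (hP : ∀ x, P (x + U) = P x + W) :
    IsHaarIso {0, U} {0, W} P P := fun x y => by
  simp only [Set.mem_insert_iff, Set.mem_singleton_iff, sub_eq_iff_eq_add', add_zero, ← hP,
    P.injective.eq_iff]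

theorem isHaarIso_involution_pair {M : G} (hMM : M + M = 0) (hP : ∀ x, P x = x ∨ P x = x + M)
    (V : G) : IsHaarIso {V, V + M} {V, V + M} P P := by
  have hpair (d : G) : d + M ∈ ({V, V + M} : Set G) ↔ d ∈ ({V, V + M} : Set G) := by
    rw [Set.mem_insert_iff, Set.mem_insert_iff, Set.mem_singleton_iff, Set.mem_singleton_iff,
      add_left_inj, or_comm, ← eq_add_neg_iff_add_eq, neg_eq_of_add_eq_zero_left hMM]
  have hdiff (x y : G) : P y - P x = y - x ∨ P y - P x = y - x + M := by
    rcases hP x with hx | hx <;> rcases hP y with hy | hy <;> rw [hx, hy]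
    · exact Or.inl rfl
    · exact Or.inr (add_sub_right_comm y M x)
    · right
      linear_combination (norm := module) -hMM
    · exact Or.inl (add_sub_add_right_eq_sub y x M)
  intro x y
  rcases hdiff x y with h | h
  · rw [h]
  · rw [h, hpair]

/-- The set `{0, x} ∪ {z, z + M}`, where `M` is meant to be an involution. For `M = m` in
`ℤ/2m`, the sets `S` and `{0, u + m, v, v + m}` of the theorem are obtained from `x = u` and
`x = u + m`. -/
def shiftedPairs (M x z : G) : Set G := {0, x, z, z + M}

theorem pair_union_pair (M x z : G) : {0, x} ∪ {z, z + M} = shiftedPairs M x z := by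
  simp only [shiftedPairs, Set.insert_union, Set.singleton_union]

theorem shiftedPairs_add_involution {M : G} (hMM : M + M = 0) (x z : G) :
    shiftedPairs M x (z + M) = shiftedPairs M x z := by
  rw [shiftedPairs, add_assoc, hMM, add_zero, Set.pair_comm, shiftedPairs]

theorem closure_shiftedPairs {M U : G} (hM : M ∈ AddSubgroup.closure {U}) (V : G) :
    AddSubgroup.closure (shiftedPairs M U V) = AddSubgroup.closure {U, V} := by
  have hU : U ∈ AddSubgroup.closure {U, V} := AddSubgroup.subset_closure (by simp)
  have hV : V ∈ AddSubgroup.closure {U, V} := AddSubgroup.subset_closure (by simp)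
  have hM' : M ∈ AddSubgroup.closure {U, V} := AddSubgroup.closure_mono (by simp) hM
  refine le_antisymm ((AddSubgroup.closure_le _).2 ?_) (AddSubgroup.closure_mono ?_)
  · rintro _ (rfl | rfl | rfl | rfl)
    exacts [zero_mem _, hU, hV, add_mem hV hM']
  · rintro _ (rfl | rfl) <;> simp [shiftedPairs]

theorem exists_isHaarIso_twist {M U : G} (hMM : M + M = 0) (A : Set G)
    (hU : ∀ x, x + U ∈ A ↔ x ∉ A) (hM : ∀ x, x + M ∈ A ↔ x ∈ A) (V : G) :
    ∃ P, IsHaarIso (shiftedPairs M U V) (shiftedPairs M (U + M) V) P P := by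
  classical
  let p (x : G) : G := if x ∈ A then x + M else x
  have hp : Function.Involutive p := by
    intro x
    by_cases hx : x ∈ A
    · simp only [p, if_pos hx, if_pos ((hM x).2 hx), add_assoc, hMM, add_zero]
    · simp only [p, if_neg hx]
  refine ⟨hp.toPerm, ?_⟩
  rw [← pair_union_pair, ← pair_union_pair]
  refine (isHaarIso_zero_pair fun x => ?_).union (isHaarIso_involution_pair hMM (fun x => ?_) V)
  · change p (x + U) = p x + (U + M)
    by_cases hx : x ∈ A
    · simp only [p, hU, hx, if_true, not_true_eq_false, if_false]
      linear_combination (norm := module) -hMM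
    · simp only [p, hU, hx, if_false, not_false_eq_true, if_true]
      exact add_assoc x U M
  · exact (ite_eq_or_eq (x ∈ A) (x + M) x).symm

end HaarGraph

section AffineEquivalence

variable {R : Type*} [CommRing R] {S T T' : Set R} {M : R}

/-- `T` is carried onto `S` by an affine bijection `t ↦ a t + b` of the ring `R`. -/
def AffinelyEquivalent (T S : Set R) : Prop :=
  ∃ (a : Rˣ) (b : R), (fun t => a * t + b) '' T = S

theorem AffinelyEquivalent.trans (h : AffinelyEquivalent T T') (h' : AffinelyEquivalent T' S) :
    AffinelyEquivalent T S := by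
  obtain ⟨a, b, rfl⟩ := h
  obtain ⟨a', b', rfl⟩ := h'
  refine ⟨a' * a, a' * b + b', ?_⟩
  rw [Set.image_image]
  refine Set.image_congr fun t _ => ?_
  rw [Units.val_mul]
  ring

theorem isHaarIso_affine (T : Set R) (a : Rˣ) (b c : R) :
    IsHaarIso T ((fun t => a * t + b) '' T) ((Units.mulLeft a).trans (Equiv.addRight c))
      ((Units.mulLeft a).trans (Equiv.addRight (c + b))) := by
  intro x y
  have hinj : Function.Injective fun t => (a : R) * t + b :=
    (add_left_injective b).comp a.mulLeft.injective
  have hxy : a * y + (c + b) - (a * x + c) = a * (y - x) + b := by ring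
  simp only [Equiv.trans_apply, Units.mulLeft_apply, Equiv.coe_addRight, hxy]
  exact hinj.mem_set_image.symm

theorem AffinelyEquivalent.nonempty_iso (h : AffinelyEquivalent T S) :
    Nonempty (haarGraph S ≃g haarGraph T) := by
  obtain ⟨a, b, rfl⟩ := h
  exact ⟨(isHaarIso_affine T a b 0).symm.toIso⟩

theorem IsHaarIso.exists_affinelyEquivalent {P Q : Equiv.Perm R} (h : IsHaarIso S T P Q) :
    ∃ T' P' Q', AffinelyEquivalent T T' ∧ IsHaarIso S T' P' Q' ∧ P' 0 = 0 ∧ Q' 0 = 0 :=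
  ⟨_, _, _, ⟨1, P 0 - Q 0, rfl⟩, h.trans (isHaarIso_affine T 1 (P 0 - Q 0) (-P 0)),
    by simp, by simp [← sub_eq_add_neg]⟩

theorem affinelyEquivalent_shiftedPairs_sub (hMM : M + M = 0) (x z : R) :
    AffinelyEquivalent (shiftedPairs M x z) (shiftedPairs M x (x - z)) := by
  refine ⟨-1, x, ?_⟩
  have hzM : x - (z + M) = x - z + M := by linear_combination -hMM
  simp only [shiftedPairs, Set.image_insert_eq, Set.image_singleton, Units.val_neg, Units.val_one,
    neg_one_mul, neg_add_eq_sub, sub_zero, sub_self, hzM]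
  exact Set.insert_comm _ _ _

theorem affinelyEquivalent_shiftedPairs_mul (a : Rˣ) (ha : a * M = M) (x z : R) :
    AffinelyEquivalent (shiftedPairs M x z) (shiftedPairs M (a * x) (a * z)) := by
  refine ⟨a, 0, ?_⟩
  simp only [shiftedPairs, Set.image_insert_eq, Set.image_singleton, mul_zero, add_zero, mul_add,
    ha]

end AffineEquivalence

section Rigidity

variable {G : Type*} [AddCommGroup G] {T : Set G} {P Q : Equiv.Perm G} {M U V W : G}

namespace IsHaarIso

theorem exists_pairs (h : IsHaarIso (shiftedPairs M U V) T P Q) (hP : P 0 = 0) (hQ : Q 0 = 0)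
    (hS : StabilizerInvariant (shiftedPairs M U V) {0, U})
    (hdisj : Disjoint ({0, U} : Set G) {V, V + M}) (hM : M ≠ 0) (hMM : M + M = 0)
    (huniq : ∀ d : G, d + d = 0 → d = 0 ∨ d = M) :
    ∃ W Z, T = shiftedPairs M W Z ∧ IsHaarIso {0, U} {0, W} P Q ∧
      IsHaarIso {V, V + M} {Z, Z + M} P Q ∧ ∀ x, P (x + M) = P x + M := by
  have hB := h.restrict hP hS
  have hC := h.restrict hP hS.sdiff
  rw [← pair_union_pair, Set.union_sdiff_cancel_left hdisj.le_bot, Set.image_pair] at hC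
  rw [Set.image_pair, hQ] at hB
  obtain ⟨hZ, hPM⟩ := hC.map_add_involution hM hMM huniq
  rw [hZ] at hC
  refine ⟨Q U, Q V, ?_, hB, hC, hPM⟩
  rw [← pair_union_pair, ← hB.image_eq hP, ← hC.image_eq hP, ← Set.image_union, pair_union_pair,
    h.image_eq hP]

theorem addOrderOf_eq (h : IsHaarIso {0, U} {0, W} P Q) (hU : U ≠ 0) (hP : P 0 = 0)
    (hQ : Q 0 = 0) : addOrderOf U = addOrderOf W := by
  rw [addOrderOf_eq_addOrderOf_iff]
  intro j
  rw [← h.map_nsmul hU hP hQ, ← P.injective.eq_iff, hP]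

end IsHaarIso

end Rigidity

theorem natCast_add_self_zmod (m : ℕ) : (m : ZMod (2 * m)) + m = 0 := by
  rw [← two_mul]
  exact_mod_cast ZMod.natCast_self (2 * m)

theorem eq_zero_or_eq_natCast_of_add_self {m : ℕ} (x : ZMod (2 * m)) (hx : x + x = 0) :
    x = 0 ∨ x = m := by
  obtain ⟨z, rfl⟩ := ZMod.intCast_surjective x
  rw [← two_mul, ← Int.cast_two, ← Int.cast_mul, ZMod.intCast_zmod_eq_zero_iff_dvd, Nat.cast_mul,
    Nat.cast_two, mul_dvd_mul_iff_left two_ne_zero] at hx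
  obtain ⟨c, rfl⟩ := hx
  obtain ⟨d, rfl | rfl⟩ := Int.even_or_odd' c
  · left
    push_cast
    linear_combination (d : ZMod (2 * m)) * natCast_add_self_zmod m
  · right
    push_cast
    linear_combination (d : ZMod (2 * m)) * natCast_add_self_zmod m

theorem exists_unit_mul_eq_of_addOrderOf_eq {n : ℕ} [NeZero n] {x y : ZMod n}
    (h : addOrderOf x = addOrderOf y) : ∃ a : (ZMod n)ˣ, y = a * x := by
  have hn : n ≠ 0 := NeZero.ne n
  have hform (x : ZMod n) :
      ∃ d : ℕ, d ∣ n ∧ (∃ a : (ZMod n)ˣ, x = a * d) ∧ addOrderOf x = n / d := by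
    obtain ⟨d, hd, a, ha, rfl⟩ := ZMod.eq_unit_mul_divisor x
    have horder : addOrderOf (a * d : ZMod n) = addOrderOf (d : ZMod n) := by
      rw [addOrderOf_eq_addOrderOf_iff]
      intro j
      rw [← mul_smul_comm, ha.mul_right_eq_zero]
    refine ⟨d, hd, ⟨ha.unit, rfl⟩, ?_⟩
    rw [horder, ZMod.addOrderOf_coe d hn, Nat.gcd_eq_right hd]
  obtain ⟨d, hd, ⟨a, rfl⟩, hx⟩ := hform x
  obtain ⟨e, he, ⟨b, rfl⟩, hy⟩ := hform y
  rw [hx, hy] at h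
  obtain rfl : d = e := by
    rw [← Nat.div_div_self hd hn, h, Nat.div_div_self he hn]
  exact ⟨b * a⁻¹, by rw [Units.val_mul, mul_assoc, Units.inv_mul_cancel_left]⟩

theorem isCoprime_of_closure_pair_eq_top {n u : ℕ} {v : ℤ} (hu : u ∣ n)
    (h : AddSubgroup.closure {(u : ZMod n), (v : ZMod n)} = ⊤) : IsCoprime (u : ℤ) v := by
  obtain ⟨i, j, hij⟩ := AddSubgroup.mem_closure_pair.1 (h ▸ AddSubgroup.mem_top (1 : ZMod n))
  have hmod : ((i * u + j * v - 1 : ℤ) : ZMod n) = 0 := by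
    push_cast
    rw [← zsmul_eq_mul, ← zsmul_eq_mul, hij, sub_self]
  rw [ZMod.intCast_zmod_eq_zero_iff_dvd] at hmod
  obtain ⟨c, hc⟩ := (Int.natCast_dvd_natCast.2 hu).trans hmod
  exact ⟨i - c, j, by linear_combination hc⟩

theorem le_val_add_natCast_iff {u : ℕ} (hu : 0 < u) (x : ZMod (2 * u)) :
    u ≤ (x + u).val ↔ ¬ u ≤ x.val := by
  have : NeZero (2 * u) := ⟨by omega⟩
  have hx := x.val_lt
  rw [ZMod.val_add, ZMod.val_natCast, Nat.mod_eq_of_lt (by omega : u < 2 * u)]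
  rcases lt_or_ge x.val u with h | h
  · rw [Nat.mod_eq_of_lt (by omega)]
    omega
  · rw [Nat.mod_eq_sub_mod (by omega), Nat.mod_eq_of_lt (by omega)]
    omega

theorem exists_isHaarIso_shiftedPairs_add {m u : ℕ} (hu : 0 < u) (hum : 2 * u ∣ m)
    (V : ZMod (2 * m)) :
    ∃ P, IsHaarIso (shiftedPairs (m : ZMod (2 * m)) u V) (shiftedPairs (m : ZMod (2 * m)) (u + m) V)
      P P := by
  let r := ZMod.castHom (hum.mul_left 2) (ZMod (2 * u))
  refine exists_isHaarIso_twist (natCast_add_self_zmod m) {x | u ≤ (r x).val} (fun x => ?_)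
    (fun x => ?_) V
  · change u ≤ (r (x + u)).val ↔ ¬ u ≤ (r x).val
    rw [map_add, map_natCast]
    exact le_val_add_natCast_iff hu (r x)
  · change u ≤ (r (x + m)).val ↔ u ≤ (r x).val
    rw [map_add, map_natCast, (ZMod.natCast_eq_zero_iff m (2 * u)).2 hum, add_zero]

section NormalForm

variable {m u k : ℕ} {v z : ℤ}

theorem addOrderOf_natCast_zmod (hm : m = u * k) (hm0 : m ≠ 0) :
    addOrderOf (u : ZMod (2 * m)) = 2 * k := by
  have hu : 0 < u := Nat.pos_of_ne_zero fun h => hm0 (by rw [hm, h, zero_mul])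
  have hn : 2 * m = u * (2 * k) := by rw [hm, mul_left_comm]
  rw [ZMod.addOrderOf_coe u (by positivity), hn, Nat.gcd_mul_right_left,
    Nat.mul_div_cancel_left _ hu]

theorem disjoint_pairs_of_isCoprime (hum : u ∣ m) (hu : 1 < u) (h : IsCoprime (u : ℤ) v) :
    Disjoint ({0, (u : ZMod (2 * m))} : Set (ZMod (2 * m)))
      {(v : ZMod (2 * m)), (v : ZMod (2 * m)) + m} := by
  let r := ZMod.castHom (hum.mul_left 2) (ZMod u)
  have hv : (v : ZMod u) ≠ 0 := fun h0 => by
    rw [ZMod.intCast_zmod_eq_zero_iff_dvd] at h0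
    have := Int.isUnit_iff.1 (h.isUnit_of_dvd' dvd_rfl h0)
    omega
  have hru : ∀ x ∈ ({0, (u : ZMod (2 * m))} : Set (ZMod (2 * m))), r x = 0 := by
    rintro _ (rfl | rfl) <;> simp
  have hrv : ∀ x ∈ ({(v : ZMod (2 * m)), (v : ZMod (2 * m)) + m} : Set (ZMod (2 * m))),
      r x = v := by
    rintro _ (rfl | rfl) <;> simp [(ZMod.natCast_eq_zero_iff m u).2 hum]
  exact Set.disjoint_left.2 fun x hx hx' => hv ((hrv x hx').symm.trans (hru x hx))

theorem IsHaarIso.exists_unit_of_shiftedPairs (hm : m = u * k) (hu : 1 < u) (hk : 0 < k)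
    (hcop : IsCoprime (u : ℤ) v) {T : Set (ZMod (2 * m))} {P Q : Equiv.Perm (ZMod (2 * m))}
    (hstab : StabilizerInvariant (shiftedPairs (m : ZMod (2 * m)) u v) {0, (u : ZMod (2 * m))})
    (h : IsHaarIso (shiftedPairs (m : ZMod (2 * m)) u v) T P Q) (hP : P 0 = 0) (hQ : Q 0 = 0) :
    ∃ (a : (ZMod (2 * m))ˣ) (z : ℤ), a * (m : ZMod (2 * m)) = m ∧
      T = shiftedPairs (m : ZMod (2 * m)) (a * u) (a * z) ∧
      IsHaarIso {0, (u : ZMod (2 * m))} {0, a.val * u} P Q ∧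
      IsHaarIso {(v : ZMod (2 * m)), (v : ZMod (2 * m)) + m} {a.val * z, a.val * z + m} P Q := by
  have hm0 : m ≠ 0 := by rw [hm]; positivity
  have : NeZero (2 * m) := ⟨by positivity⟩
  have horder := addOrderOf_natCast_zmod hm hm0
  have hU : (u : ZMod (2 * m)) ≠ 0 := by
    rw [Ne, ← AddMonoid.addOrderOf_eq_one_iff, horder]
    omega
  have hM : (m : ZMod (2 * m)) ≠ 0 := fun h0 =>
    absurd (Nat.le_of_dvd (by omega) ((ZMod.natCast_eq_zero_iff m (2 * m)).1 h0)) (by omega)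
  have hMU : (m : ZMod (2 * m)) = k • (u : ZMod (2 * m)) := by
    rw [nsmul_eq_mul, ← Nat.cast_mul, mul_comm k u, hm]
  obtain ⟨W, Z, hT, hB, hC, hPM⟩ := h.exists_pairs hP hQ hstab
    (disjoint_pairs_of_isCoprime (Dvd.intro k hm.symm) hu hcop) hM (natCast_add_self_zmod m)
    eq_zero_or_eq_natCast_of_add_self
  obtain ⟨a, rfl⟩ := exists_unit_mul_eq_of_addOrderOf_eq (hB.addOrderOf_eq hU hP hQ)
  obtain ⟨z, hz⟩ := ZMod.intCast_surjective (a⁻¹.val * Z)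
  obtain rfl : Z = a * z := by rw [hz, Units.mul_inv_cancel_left]
  refine ⟨a, z, ?_, hT, hB, hC⟩
  calc a * (m : ZMod (2 * m)) = k • (a.val * u) := by rw [hMU, mul_smul_comm]
    _ = P (0 + m) := by rw [zero_add, hMU, hB.map_nsmul hU hP hQ]
    _ = m := by rw [hPM, hP, zero_add]

theorem dvd_sub_of_isHaarIso (hm : m = u * k) (hu : 0 < u) (hk : 2 < k)
    {P Q : Equiv.Perm (ZMod (2 * m))} {a : (ZMod (2 * m))ˣ}
    (hB : IsHaarIso {0, (u : ZMod (2 * m))} {0, a.val * u} P Q)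
    (hC : IsHaarIso {(v : ZMod (2 * m)), (v : ZMod (2 * m)) + m} {a.val * z, a.val * z + m} P Q)
    (hP : P 0 = 0) (hQ : Q 0 = 0) : (k : ℤ) ∣ v - z := by
  have hm0 : m ≠ 0 := by rw [hm]; positivity
  have : NeZero (2 * m) := ⟨by positivity⟩
  have horder := addOrderOf_natCast_zmod hm hm0
  have hU : (u : ZMod (2 * m)) ≠ 0 := by
    rw [Ne, ← AddMonoid.addOrderOf_eq_one_iff, horder]
    omega
  have hW : 4 • (a.val * u) ≠ 0 := by
    rw [Ne, ← addOrderOf_dvd_iff_nsmul_eq_zero, ← hB.addOrderOf_eq hU hP hQ, horder]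
    exact fun h => absurd (Nat.le_of_dvd four_pos h) (by omega)
  have hcomm : u • (v : ZMod (2 * m)) = (v : ZMod (2 * m)).val • (u : ZMod (2 * m)) := by
    rw [nsmul_eq_mul, nsmul_eq_mul, ZMod.natCast_zmod_val]
    exact mul_comm _ _
  have htwo := hB.two_nsmul_nsmul_eq hC hU (natCast_add_self_zmod m) hW hP hQ hcomm
  simp only [nsmul_eq_mul, ZMod.natCast_zmod_val, Nat.cast_ofNat] at htwo
  have hzero : ((2 * (u * (v - z)) : ℤ) : ZMod (2 * m)) = 0 := by
    push_cast
    refine a.mul_right_eq_zero.1 ?_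
    linear_combination -htwo
  rwa [ZMod.intCast_zmod_eq_zero_iff_dvd, hm, Nat.cast_mul, Nat.cast_mul, Nat.cast_two,
    mul_dvd_mul_iff_left two_ne_zero, mul_dvd_mul_iff_left (by exact_mod_cast hu.ne')] at hzero

theorem two_dvd_sub_or_two_dvd_sub_of_isCoprime (h : IsCoprime (u : ℤ) v)
    (h' : IsCoprime (u : ℤ) z) : 2 ∣ v - z ∨ 2 ∣ v - (u - z) := by
  have hodd {w : ℤ} (hw : IsCoprime (u : ℤ) w) : ¬ (2 ∣ (u : ℤ) ∧ 2 ∣ w) := fun h2 =>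
    absurd (hw.isUnit_of_dvd' h2.1 h2.2) (by decide)
  have := hodd h
  have := hodd h'
  omega

theorem haarGraph_shiftedPairs_connected_iff (hum : u ∣ m) :
    (haarGraph (shiftedPairs (m : ZMod (2 * m)) u v)).Connected ↔
      AddSubgroup.closure {(u : ZMod (2 * m)), (v : ZMod (2 * m))} = ⊤ := by
  have hmem : (m : ZMod (2 * m)) ∈ AddSubgroup.closure {(u : ZMod (2 * m))} := by
    obtain ⟨k, hk⟩ := hum
    refine AddSubgroup.mem_closure_singleton.2 ⟨k, ?_⟩
    rw [zsmul_eq_mul, Int.cast_natCast, ← Nat.cast_mul, mul_comm k u, ← hk]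
  rw [haarGraph_connected_iff, closure_shiftedPairs hmem]
  exact Or.inl rfl

theorem exists_affinelyEquivalent_shiftedPairs_of_iso (hm : m = u * k) (hu : 1 < u)
    (hk : 2 ≤ k) {T : Set (ZMod (2 * m))}
    (hv : AddSubgroup.closure {(u : ZMod (2 * m)), (v : ZMod (2 * m))} = ⊤)
    (hstab : StabilizerInvariant (shiftedPairs (m : ZMod (2 * m)) u v) {0, (u : ZMod (2 * m))})
    (f : haarGraph (shiftedPairs (m : ZMod (2 * m)) u v) ≃g haarGraph T) :
    ∃ z : ℤ, AffinelyEquivalent T (shiftedPairs (m : ZMod (2 * m)) u z) ∧ IsCoprime (u : ℤ) z ∧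
      (k : ℤ) ∣ v - z := by
  have : NeZero (2 * m) := ⟨by rw [hm]; positivity⟩
  have hum : u ∣ m := Dvd.intro k hm.symm
  have hcop := isCoprime_of_closure_pair_eq_top (hum.mul_left 2) hv
  have hconn := (haarGraph_shiftedPairs_connected_iff hum).2 hv
  obtain ⟨P₀, Q₀, h₀⟩ := exists_isHaarIso hconn f
  obtain ⟨T', P, Q, hT, h, hP, hQ⟩ := h₀.exists_affinelyEquivalent
  obtain ⟨a, z, haM, rfl, hB, hC⟩ := h.exists_unit_of_shiftedPairs hm hu (by omega) hcop hstab hP hQ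
  have hTz : AffinelyEquivalent T (shiftedPairs (m : ZMod (2 * m)) u z) := by
    have hinv := affinelyEquivalent_shiftedPairs_mul a⁻¹
      ((Units.inv_mul_eq_iff_eq_mul a).2 haM.symm) (a.val * u) (a.val * z)
    rw [Units.inv_mul_cancel_left, Units.inv_mul_cancel_left] at hinv
    exact hT.trans hinv
  obtain ⟨g⟩ := hTz.nonempty_iso
  have hconn' := (SimpleGraph.Iso.connected_iff (f.trans g.symm)).1 hconn
  have hcop' : IsCoprime (u : ℤ) z := isCoprime_of_closure_pair_eq_top (hum.mul_left 2)
    ((haarGraph_shiftedPairs_connected_iff hum).1 hconn')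
  have hkz : (k : ℤ) ∣ v - z ∨ (k : ℤ) ∣ v - (u - z) := by
    rcases hk.eq_or_lt with rfl | hk
    · exact two_dvd_sub_or_two_dvd_sub_of_isCoprime hcop hcop'
    · exact Or.inl (dvd_sub_of_isHaarIso hm (by omega) hk hB hC hP hQ)
  rcases hkz with hkz | hkz
  · exact ⟨z, hTz, hcop', hkz⟩
  · have hcop_sub : IsCoprime (u : ℤ) (u - z) := by
      simpa using IsCoprime.mul_sub_left_right_iff (z := 1) |>.2 hcop'
    refine ⟨u - z, hTz.trans ?_, hcop_sub, hkz⟩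
    simpa using affinelyEquivalent_shiftedPairs_sub (natCast_add_self_zmod m) (u : ZMod (2 * m)) z

end NormalForm

section Arithmetic

variable {u k v z w : ℤ}

theorem exists_dvd_mul_sub_and_even (h : IsCoprime u z) (w : ℤ) :
    ∃ b, u ∣ b * z - w ∧ (Even u ∨ Even b) := by
  obtain ⟨s, t, hst⟩ := h
  have hb : u ∣ w * t * z - w := ⟨-(w * s), by linear_combination w * hst⟩
  rcases Int.even_or_odd u with hu | hu
  · exact ⟨w * t, hb, Or.inl hu⟩
  rcases Int.even_or_odd (w * t) with hwt | hwt
  · exact ⟨w * t, hb, Or.inr hwt⟩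
  · refine ⟨w * t + u, ?_, Or.inr (hwt.add_odd hu)⟩
    rw [add_mul, add_sub_right_comm]
    exact dvd_add hb (dvd_mul_right u z)

theorem odd_of_isCoprime_of_even {a b : ℤ} (h : IsCoprime a b) (ha : Even a) : Odd b := by
  by_contra hb
  have := h.isUnit_of_dvd' ha.two_dvd (Int.not_odd_iff_even.1 hb).two_dvd
  exact absurd this (by decide)

theorem exists_isCoprime_one_add_mul (hv : IsCoprime u v) (hz : IsCoprime u z)
    (hw : v - z = k * w) : ∃ b, IsCoprime (1 + k * b) (2 * (u * k)) ∧
      u * k ∣ (1 + k * b) * z - v ∧ (Even b ∨ Even u ∧ Even k ∧ Odd w ∧ Odd b) := by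
  obtain ⟨b, ⟨c, hc⟩, hub⟩ := exists_dvd_mul_sub_and_even hz w
  have hmul : (1 + k * b) * z = v + u * (k * c) := by linear_combination k * hc - hw
  have hcop_u : IsCoprime (1 + k * b) u := by
    refine IsCoprime.of_mul_left_left (y := z) ?_
    rw [hmul]
    exact hv.symm.add_mul_left_left (k * c)
  have hcop_k : IsCoprime (1 + k * b) k := ⟨1, -b, by ring⟩
  have hcop_two : IsCoprime (1 + k * b) 2 := by
    rcases hub with hu | ⟨d, rfl⟩
    · exact hcop_u.of_isCoprime_of_dvd_right hu.two_dvd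
    · exact ⟨1, -(k * d), by ring⟩
  refine ⟨b, hcop_two.mul_right (hcop_u.mul_right hcop_k), ⟨c, by linear_combination hmul⟩, ?_⟩
  refine (Int.even_or_odd b).imp_right fun hb => ?_
  have hu : Even u := hub.resolve_right (Int.not_even_iff_odd.2 hb)
  have hkb : Even (k * b) := by
    simpa using (odd_of_isCoprime_of_even hcop_two.symm even_two).sub_odd odd_one
  have hzb : Odd (b * z) := hb.mul (odd_of_isCoprime_of_even hz hu)
  have hw_eq : w = b * z - u * c := by linear_combination -hc
  exact ⟨hu, (Int.even_mul.1 hkb).resolve_right (Int.not_even_iff_odd.2 hb),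
    hw_eq ▸ hzb.sub_even (hu.mul_right c), hb⟩

end Arithmetic

section Normalization

variable {m u k : ℕ} {v z : ℤ}

theorem odd_mul_natCast_zmod {a : ℤ} (ha : Odd a) : (a : ZMod (2 * m)) * m = m := by
  obtain ⟨r, rfl⟩ := ha
  push_cast
  linear_combination (r : ZMod (2 * m)) * natCast_add_self_zmod m

theorem even_mul_natCast_zmod {a : ℤ} (ha : Even a) : (a : ZMod (2 * m)) * m = 0 := by
  obtain ⟨r, rfl⟩ := ha
  push_cast
  linear_combination (r : ZMod (2 * m)) * natCast_add_self_zmod m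

theorem affinelyEquivalent_shiftedPairs_of_isCoprime (hm : m = u * k) {b : ℤ}
    (hcop : IsCoprime (1 + k * b) (2 * (u * k) : ℤ)) (hdvd : (u * k : ℤ) ∣ (1 + k * b) * z - v) :
    AffinelyEquivalent (shiftedPairs (m : ZMod (2 * m)) u z)
      (shiftedPairs (m : ZMod (2 * m)) (u + b * m) v) := by
  have hn : ((2 * m : ℕ) : ℤ) = 2 * (u * k) := by rw [hm]; push_cast; rfl
  let a := ZMod.unitOfIsCoprime (1 + k * b) (hn ▸ hcop)
  have ha : (a : ZMod (2 * m)) = (1 + k * b : ℤ) := ZMod.coe_unitOfIsCoprime _ _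
  have haM : (a : ZMod (2 * m)) * m = m := by
    rw [ha, odd_mul_natCast_zmod (odd_of_isCoprime_of_even hcop.of_mul_right_left.symm even_two)]
  have hau : (a : ZMod (2 * m)) * u = u + b * m := by
    rw [ha, hm]
    push_cast
    ring
  have haz : (a : ZMod (2 * m)) * z = v ∨ (a : ZMod (2 * m)) * z = v + m := by
    rw [← sub_eq_zero, ← sub_eq_iff_eq_add']
    apply eq_zero_or_eq_natCast_of_add_self
    have hzero : ((2 * ((1 + k * b) * z - v) : ℤ) : ZMod (2 * m)) = 0 := by
      rw [ZMod.intCast_zmod_eq_zero_iff_dvd, hn]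
      exact mul_dvd_mul_left 2 hdvd
    rw [ha]
    push_cast at hzero ⊢
    linear_combination hzero
  have hscale := affinelyEquivalent_shiftedPairs_mul a haM (u : ZMod (2 * m)) z
  rcases haz with haz | haz
  · rwa [hau, haz] at hscale
  · rwa [hau, haz, shiftedPairs_add_involution (natCast_add_self_zmod m)] at hscale

theorem affinelyEquivalent_shiftedPairs_or (hm : m = u * k) (hv : IsCoprime (u : ℤ) v)
    (hz : IsCoprime (u : ℤ) z) {w : ℤ} (hw : v - z = k * w) :
    AffinelyEquivalent (shiftedPairs (m : ZMod (2 * m)) u z) (shiftedPairs (m : ZMod (2 * m)) u v) ∨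
      Even u ∧ Even k ∧ Odd w ∧ AffinelyEquivalent (shiftedPairs (m : ZMod (2 * m)) u z)
        (shiftedPairs (m : ZMod (2 * m)) (u + m) v) := by
  obtain ⟨b, hcop, hdvd, hb | ⟨hu, hk, hw, hb⟩⟩ := exists_isCoprime_one_add_mul hv hz hw
  · have haff := affinelyEquivalent_shiftedPairs_of_isCoprime hm hcop hdvd
    rw [even_mul_natCast_zmod hb, add_zero] at haff
    exact Or.inl haff
  · have haff := affinelyEquivalent_shiftedPairs_of_isCoprime hm hcop hdvd
    rw [odd_mul_natCast_zmod hb] at haff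
    exact Or.inr ⟨(Int.even_coe_nat u).1 hu, (Int.even_coe_nat k).1 hk, hw, haff⟩

theorem exists_sub_eq_mul_even_of_modEq {u k w : ℤ} (hw : v - z = 2 * k * w) (hw_odd : Odd w)
    (h : u ≡ v + k [ZMOD 2 * k]) : ∃ w', v - (2 * u - z) = 2 * k * w' ∧ Even w' := by
  obtain ⟨s, hs⟩ := h.dvd
  refine ⟨2 * s - 1 - w, by linear_combination 2 * hs - hw, ?_⟩
  exact ((even_two_mul s).sub_odd odd_one).sub_odd hw_odd

theorem affinelyEquivalent_shiftedPairs_cases (hm : m = u * k) (hu : 0 < u)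
    (hv : IsCoprime (u : ℤ) v) (hz : IsCoprime (u : ℤ) z) (hk : (k : ℤ) ∣ v - z) :
    AffinelyEquivalent (shiftedPairs (m : ZMod (2 * m)) u z) (shiftedPairs (m : ZMod (2 * m)) u v) ∨
      AffinelyEquivalent (shiftedPairs (m : ZMod (2 * m)) u z)
        (shiftedPairs (m : ZMod (2 * m)) (u + m) v) ∧ 2 ∣ u ∧ 2 * u ∣ m ∧
        ¬ ((u / 2 : ℕ) : ℤ) ≡ v + ((m / (2 * u) : ℕ) : ℤ) [ZMOD ((m / u : ℕ) : ℤ)] := by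
  obtain ⟨w, hw⟩ := hk
  refine (affinelyEquivalent_shiftedPairs_or hm hv hz hw).elim Or.inl ?_
  rintro ⟨hu2, hk2, hw_odd, haff⟩
  obtain ⟨u', rfl⟩ := hu2.two_dvd
  obtain ⟨k', rfl⟩ := hk2.two_dvd
  have hm2 : m = 2 * (2 * u') * k' := by rw [hm]; ring
  have hdiv : m / (2 * u') = 2 * k' := by rw [hm, Nat.mul_div_cancel_left _ hu]
  have hdiv2 : m / (2 * (2 * u')) = k' := by rw [hm2, Nat.mul_div_cancel_left _ (by omega)]
  by_cases hmod : (u' : ℤ) ≡ v + k' [ZMOD 2 * k']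
  · rw [Nat.cast_mul, Nat.cast_two] at hw
    obtain ⟨w', hw', hw'_even⟩ := exists_sub_eq_mul_even_of_modEq hw hw_odd hmod
    have hreflect := affinelyEquivalent_shiftedPairs_sub (natCast_add_self_zmod m)
      ((2 * u' : ℕ) : ZMod (2 * m)) z
    have hz' : IsCoprime ((2 * u' : ℕ) : ℤ) ((2 * u' : ℕ) - z) := by
      simpa using IsCoprime.mul_sub_left_right_iff (z := 1) |>.2 hz
    have hor := affinelyEquivalent_shiftedPairs_or hm hv hz'
      (w := w') (by exact_mod_cast hw')
    rw [Int.cast_sub, Int.cast_natCast] at hor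
    exact Or.inl (hreflect.trans (hor.resolve_right fun h =>
      Int.not_even_iff_odd.2 h.2.2.1 hw'_even))
  · refine Or.inr ⟨haff, ⟨u', rfl⟩, ⟨k', hm2⟩, ?_⟩
    rwa [hdiv, hdiv2, Nat.mul_div_cancel_left _ two_pos, Nat.cast_mul, Nat.cast_two]

end Normalization

theorem theorem3p1 (n m u : ℕ) (v : ℤ) (hn : n = 2 * m)
    (S : Set (ZMod n))
    (hS : S = {0, (u : ZMod n), (v : ZMod n), (v : ZMod n) + (m : ZMod n)})
    (ha : AddSubgroup.closure {(u : ZMod n), (v : ZMod n)} = ⊤)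
    (hb : 1 < u ∧ u < m ∧ u ∣ m)
    (hc : ∀ g : haarGraph S ≃g haarGraph S, g (Sum.inl 0) = Sum.inl 0 →
      g '' {Sum.inr 0, Sum.inr (u : ZMod n)} = {Sum.inr 0, Sum.inr (u : ZMod n)})
    (T : Set (ZMod n)) :
    Nonempty (haarGraph S ≃g haarGraph T) ↔
      ∃ (a : (ZMod n)ˣ) (b : ZMod n),
        (fun t : ZMod n => (a : ZMod n) * t + b) '' T = S ∨
        ((fun t : ZMod n => (a : ZMod n) * t + b) '' T =
            {0, (u : ZMod n) + (m : ZMod n), (v : ZMod n), (v : ZMod n) + (m : ZMod n)} ∧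
          2 ∣ u ∧ 2 * u ∣ m ∧
          ¬ ((u / 2 : ℕ) : ℤ) ≡ v + ((m / (2 * u) : ℕ) : ℤ) [ZMOD ((m / u : ℕ) : ℤ)]) := by
  subst hn hS
  obtain ⟨hu, hum, k, hm⟩ := hb
  constructor
  · rintro ⟨f⟩
    have hk : 2 ≤ k := by
      by_contra! hk
      exact absurd (Nat.mul_le_mul_left u (Nat.le_of_lt_succ hk)) (by omega)
    have hstab := stabilizerInvariant_of_forall_iso (B := {0, (u : ZMod (2 * m))})
      (by simpa only [Set.image_pair] using hc)
    obtain ⟨z, hT, hz, hkz⟩ := exists_affinelyEquivalent_shiftedPairs_of_iso hm hu hk ha hstab f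
    have hv := isCoprime_of_closure_pair_eq_top ((Dvd.intro k hm.symm).mul_left 2) ha
    obtain h | ⟨h, hcond⟩ := affinelyEquivalent_shiftedPairs_cases hm (by omega) hv hz hkz
    · exact (hT.trans h).imp fun a => Exists.imp fun b => Or.inl
    · exact (hT.trans h).imp fun a => Exists.imp fun b hab => Or.inr ⟨hab, hcond⟩
  · rintro ⟨a, b, h | ⟨h, -, hum', -⟩⟩
    · exact AffinelyEquivalent.nonempty_iso ⟨a, b, h⟩
    · obtain ⟨P, hP⟩ := exists_isHaarIso_shiftedPairs_add (by omega) hum' (v : ZMod (2 * m))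
      exact (AffinelyEquivalent.nonempty_iso ⟨a, b, h⟩).map hP.toIso.trans
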